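/- Work over $\mathbb{C}$. Let $n,r,k\ge 0$ be integers, let $P=\mathbb{P}^{n+r}\subset P'=\mathbb{P}^{n+r+1}$ be the hyperplane given by the vanishing of the last homogeneous coordinate, let $L\subset P'$ be a linear subspace of dimension $k+1$ such that $M=L\cap P$ is a linear subspace of dimension $k$, and let $X\subset P$ be a smooth $n$-dimensional complete intersection of multidegree $(d_1,\dots,d_r)$, $d_i\ge 1$, containing $M$. (i) If $k<\frac n2$, then there exists a smooth complete intersection $Y\subset P'$ of dimension $n+1$ and of the same multidegree $(d_1,\dots,d_r)$ such that $L\subset Y$ and $Y\cap P=X$ (as schemes). (ii) If $k<\frac{n-1}2$, then for every $Y$ as in (i) the general hyperplane $H\subset P'$ passing through $L$ (that is, every $H$ in some nonempty Zariski open subset of the projective space of hyperplanes containing $L$) cuts $Y$ in a smooth hypersurface of $Y$: the scheme $Y\cap H$ is smooth of pure dimension $n$. -/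

import Mathlib

open MvPolynomial

/-- The homogeneous coordinate ring `ℂ[X_0, …, X_N]` of `ℙ^N`. A closed subscheme of `ℙ^N` is given
by a homogeneous ideal in it; a linear subspace of dimension `k` is given by a linear subspace of
dimension `k + 1` of `ℂ^(N+1)`. -/
abbrev CoordRing (N : ℕ) : Type := MvPolynomial (Fin (N + 1)) ℂ

/-- The gradient of `f` at `x`. -/
noncomputable def grad {N : ℕ} (f : CoordRing N) (x : Fin (N + 1) → ℂ) : Fin (N + 1) → ℂ :=
  fun j => eval x (pderiv j f)

/-- The vector `x` lies on the affine cone of the subscheme defined by `I`; for `x ≠ 0` this says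
that the point `[x]` of `ℙ^N` lies on the subscheme. -/
def OnCone {N : ℕ} (I : Ideal (CoordRing N)) (x : Fin (N + 1) → ℂ) : Prop :=
  ∀ f ∈ I, eval x f = 0

/-- The subscheme of `ℙ^N` defined by the homogeneous ideal `I` contains the linear subspace
attached to `L`. -/
def ContainsLinear {N : ℕ} (I : Ideal (CoordRing N)) (L : Submodule ℂ (Fin (N + 1) → ℂ)) : Prop :=
  ∀ x ∈ L, OnCone I x

/-- The subscheme of `ℙ^N` defined by the homogeneous ideal `I` is smooth of pure codimension `c`
(Jacobian criterion): at each of its points `[x]`, the ideal `I` is generated, after inverting some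
`g` with `g(x) ≠ 0`, by `c` elements of `I` whose gradients at `x` are linearly independent.
(The punctured affine cone is a `𝔾_m`-bundle over the subscheme, so that smoothness may be tested
on the cone.) -/
def IsSmoothOfCodim {N : ℕ} (I : Ideal (CoordRing N)) (c : ℕ) : Prop :=
  ∀ x : Fin (N + 1) → ℂ, x ≠ 0 → OnCone I x →
    ∃ (F : Fin c → CoordRing N) (g : CoordRing N),
      (∀ i, F i ∈ I) ∧ LinearIndependent ℂ (fun i => grad (F i) x) ∧
      eval x g ≠ 0 ∧ ∀ f ∈ I, g * f ∈ Ideal.span (Set.range F)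

/-- `I` defines a smooth complete intersection of multidegree `(d_1, …, d_r)` in `ℙ^N`: it is
generated by `r` forms of positive degrees `d_1, …, d_r`, and the subscheme it defines is smooth of
pure codimension `r`, that is, of dimension `N - r`. -/
structure IsSmoothCompleteIntersection {N r : ℕ} (d : Fin r → ℕ) (I : Ideal (CoordRing N)) :
    Prop where
  deg_pos : ∀ i, 0 < d i
  exists_equations : ∃ F : Fin r → CoordRing N,
    (∀ i, (F i).IsHomogeneous (d i)) ∧ I = Ideal.span (Set.range F)
  smooth : IsSmoothOfCodim I r

/-- The inclusion `ℂ^(N+1) → ℂ^(N+2)`, `x ↦ (x, 0)`, which embeds `ℙ^N` in `ℙ^(N+1)` as the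
hyperplane `X_{N+1} = 0`. -/
def hyperplaneIncl (N : ℕ) : (Fin (N + 1) → ℂ) →ₗ[ℂ] (Fin (N + 1 + 1) → ℂ) where
  toFun x := Fin.snoc (α := fun _ => ℂ) x 0
  map_add' x y := by
    ext j
    refine Fin.lastCases ?_ (fun i => ?_) j <;> simp
  map_smul' c x := by
    ext j
    refine Fin.lastCases ?_ (fun i => ?_) j <;> simp

/-- Restriction of polynomials to the hyperplane `X_{N+1} = 0`. -/
noncomputable def restrictToHyperplane (N : ℕ) : CoordRing (N + 1) →+* CoordRing N :=
  (aeval (Fin.snoc (α := fun _ => CoordRing N) (fun i => X i) 0) :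
    CoordRing (N + 1) →ₐ[ℂ] CoordRing N).toRingHom

/-- The ideal, in the coordinate ring of the hyperplane `ℙ^N`, of the scheme-theoretic intersection
with `ℙ^N` of the subscheme of `ℙ^(N+1)` defined by `I`. -/
noncomputable def interHyperplane {N : ℕ} (I : Ideal (CoordRing (N + 1))) : Ideal (CoordRing N) :=
  I.map (restrictToHyperplane N)

/-- The linear form `∑ a_j X_j`. -/
noncomputable def linForm {N : ℕ} (a : Fin (N + 1) → ℂ) : CoordRing N :=
  ∑ j, C (a j) * X j

/-- The property `Q` holds for the general hyperplane `∑ a_j X_j = 0` of `ℙ^N` passing through the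
linear subspace attached to `L`: it holds on a nonempty Zariski open subset `{Φ ≠ 0}` of the
projective space of all hyperplanes through it. -/
def ForGeneralHyperplaneThrough {N : ℕ} (L : Submodule ℂ (Fin (N + 1) → ℂ))
    (Q : (Fin (N + 1) → ℂ) → Prop) : Prop :=
  ∃ (m : ℕ) (Φ : MvPolynomial (Fin (N + 1)) ℂ), Φ.IsHomogeneous m ∧
    (∃ a : Fin (N + 1) → ℂ, a ≠ 0 ∧ (∀ x ∈ L, eval x (linForm a) = 0) ∧ eval a Φ ≠ 0) ∧
    ∀ a : Fin (N + 1) → ℂ, a ≠ 0 → (∀ x ∈ L, eval x (linForm a) = 0) → eval a Φ ≠ 0 → Q a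

/-! Both parts are Bertini theorems with base locus, proved by differentiating at a generic point
instead of counting dimensions of incidence varieties. If bad parameters filled no hypersurface, a
bad configuration would exist over a field `E` with algebraically independent parameters
(`exists_hypersurface_of_generic`), hence with derivations dual to them. Applying these to the
equations first puts the bad point `x` on the base locus `A x = 0`. All derivatives of `x` then lie
in the kernel of `A`, so when `s + r ≤ 2 * m` (`m` rows, `s` columns, `r` equations) some nonzero
combination of the derivations kills both `x` and the multipliers `l`. Applied to the gradient
relation, it gives a nontrivial relation between the rows of `A`, a contradiction. For (ii), the
parameters are hyperplanes through `L`, and bad means tangent to `Y`. For (i), project from a point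
`(v, 1)` of `L`. The cone over `X` contains `L` but may be singular; with `t` the last coordinate,
add `t ^ (d i - 1) * a i` to its equations of degree at least 2, where the linear form `a i`
vanishes on `M`. This changes nothing on `t = 0`, and off it the problem becomes affine: generic
perturbations `F i + a i` are smooth. -/

/-! ### Generic points and dual derivations -/

section GenericPoint

open scoped TensorProduct

/-- A field extension of `ℂ` has, for each element of a transcendence basis, a derivation that takes
the value `1` on it and `0` on the other elements of the basis. -/
theorem IsTranscendenceBasis.exists_derivation {ι E : Type} [Field E] [Algebra ℂ E] {v : ι → E}
    (hv : IsTranscendenceBasis ℂ v) (i : ι) :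
    ∃ D : Derivation ℂ E E, D (v i) = 1 ∧ ∀ j, j ≠ i → D (v j) = 0 := by
  classical
  have hb := hv.1
  let A := Algebra.adjoin ℂ (Set.range v)
  -- `E` is algebraic, hence separable in characteristic 0, over the fraction field of `A = ℂ[v]`.
  -- Therefore `Ω[E⁄ℂ]` is the base change of the differentials of `A`, and the partial derivative
  -- on `A` extends to `E`.
  have : Algebra.FormallyEtale A E := by
    open scoped IntermediateField.algebraAdjoinAdjoin in
    have h1 : Algebra.FormallyEtale A (IntermediateField.adjoin ℂ (Set.range v)) :=
      .of_isLocalization (nonZeroDivisors _)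
    have h2 : Algebra.IsAlgebraic (IntermediateField.adjoin ℂ (Set.range v)) E :=
      hv.isAlgebraic_field
    have h3 : Algebra.FormallyEtale (IntermediateField.adjoin ℂ (Set.range v)) E :=
      Algebra.FormallyEtale.of_isSeparable _ _
    exact .comp _ (IntermediateField.adjoin ℂ (Set.range v)) _
  let e := hb.aevalEquiv
  have he : ∀ p, (aeval v p : E) = e p := fun p => (hb.algebraMap_aevalEquiv p).symm
  let dl : A →ₗ[ℂ] E := (aeval v).toLinearMap ∘ₗ (pderiv i).toLinearMap ∘ₗ e.symm.toLinearMap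
  have hdl : ∀ p, dl (e p) = aeval v (pderiv i p) := fun p => by simp [dl]
  let d : Derivation ℂ A E := Derivation.mk' dl (fun a b => by
    obtain ⟨p, rfl⟩ := e.surjective a
    obtain ⟨q, rfl⟩ := e.surjective b
    rw [← map_mul, hdl, hdl, hdl, Derivation.leibniz]
    simp only [smul_eq_mul, map_add, map_mul, he]
    rfl)
  let f : Ω[E⁄ℂ] →ₗ[E] E := (d.liftKaehlerDifferential.liftBaseChange E) ∘ₗ
    (KaehlerDifferential.tensorKaehlerEquivOfFormallyEtale ℂ A E).symm.toLinearMap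
  let D : Derivation ℂ E E := f.compDer (KaehlerDifferential.D ℂ E)
  have hD : ∀ p, D (aeval v p) = aeval v (pderiv i p) := fun p => by
    rw [← hdl, he]
    change f (KaehlerDifferential.D ℂ E (algebraMap A E (e p))) = _
    simp only [f, LinearMap.comp_apply, LinearEquiv.coe_coe]
    rw [KaehlerDifferential.tensorKaehlerEquivOfFormallyEtale_symm_D_algebraMap]
    simp [d]
  refine ⟨D, ?_, fun j hj => ?_⟩
  · simpa using hD (X i)
  · simpa [pderiv_X_of_ne hj] using hD (X j)

/-- An algebraically independent family in a field extension of `ℂ` admits a dual family of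
derivations. -/
theorem AlgebraicIndependent.exists_dual_derivation {σ E : Type} [Field E] [Algebra ℂ E]
    [DecidableEq σ] {α : σ → E} (hα : AlgebraicIndependent ℂ α) :
    ∃ D : σ → Derivation ℂ E E, ∀ i j, D i (α j) = if i = j then 1 else 0 := by
  obtain ⟨t, hst, ht⟩ := exists_isTranscendenceBasis_superset (s := Set.range α) hα.coe_range
  have hinj := hα.injective
  have key : ∀ i, ∃ D : Derivation ℂ E E, ∀ j, D (α j) = if i = j then 1 else 0 := fun i => by
    obtain ⟨D, h1, h2⟩ := ht.exists_derivation ⟨α i, hst ⟨i, rfl⟩⟩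
    refine ⟨D, fun j => ?_⟩
    split_ifs with h
    · subst h; exact h1
    · exact h2 ⟨α j, hst ⟨j, rfl⟩⟩ (fun h' => h (hinj (Subtype.ext_iff.1 h')).symm)
  choose D hD using key
  exact ⟨D, hD⟩

/-- If a system of polynomial equations with parameters in `σ` and unknowns in `τ` has no solution
over any field for generic values of the parameters, then the parameters for which it has a complex
solution lie on a hypersurface. Genericity is witnessed by derivations dual to the parameters. -/
theorem exists_hypersurface_of_generic {σ τ : Type} [DecidableEq σ]
    (S : Set (MvPolynomial (σ ⊕ τ) ℂ))
    (h : ∀ (E : Type) [Field E] [Algebra ℂ E] (α : σ → E) (x : τ → E)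
      (D : σ → Derivation ℂ E E), (∀ i j, D i (α j) = if i = j then 1 else 0) →
      (∀ f ∈ S, aeval (Sum.elim α x) f = 0) → False) :
    ∃ Φ : MvPolynomial σ ℂ, Φ ≠ 0 ∧ ∀ (a : σ → ℂ) (x : τ → ℂ),
      (∀ f ∈ S, eval (Sum.elim a x) f = 0) → eval a Φ = 0 := by
  by_contra! hcon
  let J := Ideal.span S
  let T : Submonoid (MvPolynomial (σ ⊕ τ) ℂ) :=
    (nonZeroDivisors (MvPolynomial σ ℂ)).map (rename (R := ℂ) (Sum.inl : σ → σ ⊕ τ))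
  -- Elements of `J` vanish at every solution, while by `hcon` each nonzero polynomial in the
  -- parameters is nonzero at some solution.
  have hdis : Disjoint (J : Set (MvPolynomial (σ ⊕ τ) ℂ)) T := by
    rw [Set.disjoint_left]
    rintro _ hJ ⟨Φ, hΦ, rfl⟩
    obtain ⟨a, x, hS, hne⟩ := hcon Φ (nonZeroDivisors.ne_zero hΦ)
    apply hne
    have hle : J ≤ RingHom.ker (eval (Sum.elim a x)) := Ideal.span_le.2 hS
    have := hle hJ
    rw [RingHom.mem_ker] at this
    simpa [eval_rename] using this
  -- The classes of the variables modulo `P` form the generic solution; since `P` avoids `T`, the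
  -- parameters stay algebraically independent.
  obtain ⟨P, hP, hJP, hdisP⟩ := Ideal.exists_le_prime_disjoint J T hdis
  let B := MvPolynomial (σ ⊕ τ) ℂ ⧸ P
  let E := FractionRing B
  let q : MvPolynomial (σ ⊕ τ) ℂ →ₐ[ℂ] E := (Algebra.ofId B E).restrictScalars ℂ |>.comp
    (Ideal.Quotient.mkₐ ℂ P)
  have hq : ∀ f, q f = 0 ↔ f ∈ P := fun f => by
    change algebraMap B E (Ideal.Quotient.mk P f) = 0 ↔ _
    rw [FaithfulSMul.algebraMap_eq_zero_iff, Ideal.Quotient.eq_zero_iff_mem]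
  let α : σ → E := fun i => q (X (Sum.inl i))
  let x : τ → E := fun i => q (X (Sum.inr i))
  have hqx : ∀ f, aeval (Sum.elim α x) f = q f := fun f => by
    congr 1
    ext i
    rcases i with i | i <;> simp [α, x]
  have hα : AlgebraicIndependent ℂ α := by
    rw [algebraicIndependent_iff]
    intro Φ hΦ
    by_contra hne
    have h1 : aeval α Φ = q (rename Sum.inl Φ) := by
      rw [← hqx, aeval_rename]
      rfl
    rw [h1, hq] at hΦ
    exact Set.disjoint_left.1 hdisP hΦ ⟨Φ, mem_nonZeroDivisors_of_ne_zero hne, rfl⟩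
  obtain ⟨D, hD⟩ := hα.exists_dual_derivation
  exact h E α x D hD fun f hf => by
    rw [hqx, hq]
    exact hJP (Ideal.subset_span hf)

end GenericPoint

/-- Chain rule for a derivation applied to the value of a polynomial. -/
theorem Derivation.apply_aeval_mvPolynomial {K A : Type*} {σ : Type*} [Fintype σ] [CommRing K]
    [CommRing A] [Algebra K A] (D : Derivation K A A) (x : σ → A) (f : MvPolynomial σ K) :
    D (aeval x f) = ∑ s, aeval x (pderiv s f) * D (x s) := by
  classical
  induction f using MvPolynomial.induction_on with
  | C a => simp
  | add p q hp hq => simp [hp, hq, add_mul, Finset.sum_add_distrib]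
  | mul_X p i hp =>
    simp only [map_mul, aeval_X, Derivation.leibniz, hp, smul_eq_mul, map_add, pderiv_X,
      add_mul, Finset.sum_add_distrib, Finset.mul_sum]
    congr 1
    · rw [Finset.sum_eq_single i]
      · simp
      · intro s _ hs; simp [hs.symm]
      · simp
    · exact Finset.sum_congr rfl fun s _ => by ring

/-! ### Equations of subspaces and combinations of derivations -/

section LinearAlgebra

open Matrix

/-- A subspace of codimension `m` is cut out by `m` independent linear equations, the rows of a
matrix with a right inverse. -/
theorem Submodule.exists_matrix_equations {s m : ℕ} (L : Submodule ℂ (Fin s → ℂ))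
    (hL : Module.finrank ℂ L + m = s) :
    ∃ (A : Matrix (Fin m) (Fin s) ℂ) (B : Matrix (Fin s) (Fin m) ℂ), A * B = 1 ∧
      ∀ x, x ∈ L ↔ A *ᵥ x = 0 := by
  have hq : Module.finrank ℂ ((Fin s → ℂ) ⧸ L) = Module.finrank ℂ (Fin m → ℂ) := by
    have := L.finrank_quotient_add_finrank
    simp only [Module.finrank_fin_fun] at this ⊢
    omega
  let e := LinearEquiv.ofFinrankEq _ _ hq
  let f : (Fin s → ℂ) →ₗ[ℂ] (Fin m → ℂ) := e.toLinearMap ∘ₗ L.mkQ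
  have hf : LinearMap.range f = ⊤ := by
    rw [LinearMap.range_eq_top]
    exact e.surjective.comp L.mkQ_surjective
  obtain ⟨g, hg⟩ := f.exists_rightInverse_of_surjective hf
  refine ⟨LinearMap.toMatrix' f, LinearMap.toMatrix' g, ?_, fun x => ?_⟩
  · rw [← LinearMap.toMatrix'_comp, hg, LinearMap.toMatrix'_id]
  · rw [LinearMap.toMatrix'_mulVec]
    simp [f]

theorem Matrix.finrank_ker_mulVecLin_of_mul_eq_one {E : Type*} [Field E] {s m : ℕ}
    {A : Matrix (Fin m) (Fin s) E} {B : Matrix (Fin s) (Fin m) E} (h : A * B = 1) :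
    Module.finrank E (LinearMap.ker A.mulVecLin) + m = s := by
  have h1 := A.mulVecLin.finrank_range_add_finrank_ker
  have h2 : LinearMap.range A.mulVecLin = ⊤ := by
    rw [LinearMap.range_eq_top]
    intro y
    exact ⟨B *ᵥ y, by simp [h]⟩
  rw [h2, finrank_top] at h1
  simp only [Module.finrank_fin_fun] at h1
  omega

theorem Derivation.sum_smul_apply {E ι : Type*} [Field E] [Algebra ℂ E] [Fintype ι]
    (D : ι → Derivation ℂ E E) (c : ι → E) (a : E) :
    (∑ j, c j • D j) a = ∑ j, c j * D j a := by
  let ev : Derivation ℂ E E →+ E :=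
    { toFun := fun D => D a, map_zero' := rfl, map_add' := fun _ _ => rfl }
  change ev (∑ j, c j • D j) = _
  rw [map_sum]
  rfl

/-- If the values of all derivations on the tuple `x` lie in a subspace `K`, then enough derivations
have a nontrivial linear combination which kills `x` and `y`. -/
theorem Derivation.exists_combination_eq_zero {E ι : Type*} [Field E] [Algebra ℂ E] [Fintype ι]
    {m s : ℕ} (D : Fin m → Derivation ℂ E E) (x : Fin s → E) (y : ι → E)
    (K : Submodule E (Fin s → E)) (hK : ∀ D' : Derivation ℂ E E, (fun t => D' (x t)) ∈ K)
    (hdim : Module.finrank E K + Fintype.card ι < m) :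
    ∃ c : Fin m → E, c ≠ 0 ∧ (∀ t, (∑ j, c j • D j) (x t) = 0) ∧
      ∀ i, (∑ j, c j • D j) (y i) = 0 := by
  let f₁ : (Fin m → E) →ₗ[E] K := LinearMap.codRestrict K
    (Matrix.mulVecLin (Matrix.of fun t j => D j (x t))) (fun c => by
      convert hK (∑ j, c j • D j) using 1
      ext t
      simp [Matrix.mulVec, dotProduct, Derivation.sum_smul_apply, mul_comm])
  let f₂ : (Fin m → E) →ₗ[E] (ι → E) := Matrix.mulVecLin (Matrix.of fun t j => D j (y t))
  have hker : LinearMap.ker (f₁.prod f₂) ≠ ⊥ := by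
    apply LinearMap.ker_ne_bot_of_finrank_lt
    rw [Module.finrank_prod, Module.finrank_fintype_fun_eq_card, Module.finrank_fin_fun]
    exact hdim
  obtain ⟨c, hc, hne⟩ := (Submodule.ne_bot_iff _).1 hker
  replace hc : f₁ c = 0 ∧ f₂ c = 0 := Prod.mk_eq_zero.1 hc
  refine ⟨c, hne, fun t => ?_, fun i => ?_⟩
  · have := congrFun (congrArg Subtype.val hc.1) t
    simpa [f₁, Matrix.mulVec, dotProduct, Derivation.sum_smul_apply, mul_comm] using this
  · have := congrFun hc.2 i
    simpa [f₂, Matrix.mulVec, dotProduct, Derivation.sum_smul_apply, mul_comm] using this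

end LinearAlgebra

/-! ### Contradictions at the generic point -/

section GenericSolutions

open Matrix

variable {E : Type} [Field E] [Algebra ℂ E] {r m s : ℕ}

theorem Derivation.mulVec_map_algebraMap (D : Derivation ℂ E E) (A : Matrix (Fin m) (Fin s) ℂ)
    (x : Fin s → E) (j : Fin m) :
    D ((A.map (algebraMap ℂ E) *ᵥ x) j) = (A.map (algebraMap ℂ E) *ᵥ fun t => D (x t)) j := by
  simp [Matrix.mulVec, dotProduct]

theorem Matrix.map_algebraMap_mul_eq_one {A : Matrix (Fin m) (Fin s) ℂ}
    {B : Matrix (Fin s) (Fin m) ℂ} (h : A * B = 1) :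
    A.map (algebraMap ℂ E) * B.map (algebraMap ℂ E) = 1 := by
  rw [← Matrix.map_mul, h, Matrix.map_one _ (map_zero _) (map_one _)]

/-- The rows of a matrix with a right inverse are linearly independent. -/
theorem Matrix.eq_zero_of_vecMul_map_eq_zero {A : Matrix (Fin m) (Fin s) ℂ}
    {B : Matrix (Fin s) (Fin m) ℂ} (h : A * B = 1) {c : Fin m → E}
    (hc : c ᵥ* A.map (algebraMap ℂ E) = 0) : c = 0 := by
  have := congrArg (· ᵥ* B.map (algebraMap ℂ E)) hc
  simpa [Matrix.vecMul_vecMul, Matrix.map_algebraMap_mul_eq_one h] using this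

/-- A generic hyperplane through the linear subspace `A x = 0` is nowhere tangent to the complete
intersection `G = 0`. -/
theorem generic_hyperplane_not_tangent {d : Fin r → ℕ} {G : Fin r → MvPolynomial (Fin s) ℂ}
    (hG : ∀ i, (G i).IsHomogeneous (d i)) {A : Matrix (Fin m) (Fin s) ℂ}
    {B : Matrix (Fin s) (Fin m) ℂ} (hAB : A * B = 1) (hdim : s + r ≤ 2 * m)
    (D : Fin m → Derivation ℂ E E) (α : Fin m → E) (hD : ∀ i j, D i (α j) = if i = j then 1 else 0)
    (x : Fin s → E) (l : Fin r → E) (t₀ : Fin s) (hx : x t₀ = 1) (hGx : ∀ i, aeval x (G i) = 0)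
    (htan : ∀ t, (α ᵥ* A.map (algebraMap ℂ E)) t = ∑ i, l i * aeval x (pderiv t (G i))) :
    False := by
  set A' := A.map (algebraMap ℂ E) with hA'
  have hDG : ∀ (D' : Derivation ℂ E E), ∑ t, (α ᵥ* A') t * D' (x t) = 0 := fun D' => by
    simp only [htan, Finset.sum_mul]
    rw [Finset.sum_comm]
    refine Finset.sum_eq_zero fun i _ => ?_
    have := D'.apply_aeval_mvPolynomial x (G i)
    rw [hGx, map_zero] at this
    simp only [mul_assoc, ← Finset.mul_sum, ← this, mul_zero]
  have heuler : α ⬝ᵥ (A' *ᵥ x) = 0 := by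
    rw [Matrix.dotProduct_mulVec, dotProduct]
    simp only [htan, Finset.sum_mul]
    rw [Finset.sum_comm]
    refine Finset.sum_eq_zero fun i _ => ?_
    have := congrArg (aeval x) (hG i).sum_X_mul_pderiv
    simp only [map_sum, map_mul, aeval_X, map_nsmul, hGx, smul_zero] at this
    rw [← mul_zero (l i), ← this, Finset.mul_sum]
    exact Finset.sum_congr rfl fun t _ => by ring
  -- Applying `D j` to `heuler` leaves `(A' *ᵥ x) j` plus the pairing of `α ᵥ* A'` with `D j x`,
  -- which vanishes by `hDG`.
  have hker : A' *ᵥ x = 0 := by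
    ext j
    have h1 := congrArg (D j) heuler
    simp only [dotProduct, map_sum, Derivation.leibniz, smul_eq_mul, map_zero, hD,
      Finset.sum_add_distrib] at h1
    have h2 : ∑ i, α i * D j ((A' *ᵥ x) i) = 0 := by
      have := hDG (D j)
      simp only [hA', Derivation.mulVec_map_algebraMap]
      rw [← this]
      exact Matrix.dotProduct_mulVec _ _ _
    rw [h2, zero_add] at h1
    simpa using h1
  let ev : (Fin s → E) →ₗ[E] E := LinearMap.proj t₀
  -- The normalisation `x t₀ = 1` makes the derivatives of that coordinate vanish. As `x` is in the
  -- kernel but not in `K`, this saves one dimension, needed to fit the `r` multipliers.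
  let K := LinearMap.ker A'.mulVecLin ⊓ LinearMap.ker ev
  have hK : Module.finrank E K + r < m := by
    have h1 : K < LinearMap.ker A'.mulVecLin := by
      refine lt_of_le_of_ne inf_le_left fun h => ?_
      have h2 : x ∈ K := by
        rw [h]
        simpa using hker
      have h3 : x t₀ = 0 := h2.2
      rw [hx] at h3
      exact one_ne_zero h3
    have h2 := Submodule.finrank_lt_finrank_of_lt h1
    have h3 := Matrix.finrank_ker_mulVecLin_of_mul_eq_one
      (Matrix.map_algebraMap_mul_eq_one (E := E) hAB)
    rw [← hA'] at h3
    omega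
  obtain ⟨c, hc, hcx, hcl⟩ := Derivation.exists_combination_eq_zero D x l K (fun D' => by
    refine ⟨?_, ?_⟩
    · rw [SetLike.mem_coe, LinearMap.mem_ker, Matrix.mulVecLin_apply]
      ext j
      rw [hA', ← Derivation.mulVec_map_algebraMap, ← hA', hker]
      simp
    · change D' (x t₀) = 0
      rw [hx, Derivation.map_one_eq_zero]) (by simpa using hK)
  refine hc (Matrix.eq_zero_of_vecMul_map_eq_zero (E := E) hAB ?_)
  set D' := ∑ j, c j • D j with hD'
  have hDα : ∀ i, D' (α i) = c i := fun i => by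
    rw [hD', Derivation.sum_smul_apply]
    simp [hD]
  ext t
  have h1 := congrArg D' (htan t)
  have h2 : ∀ f : MvPolynomial (Fin s) ℂ, D' (aeval x f) = 0 := fun f => by
    rw [Derivation.apply_aeval_mvPolynomial]
    simp [hcx]
  simp only [map_sum, Derivation.leibniz, h2, hcl, smul_zero, add_zero,
    Finset.sum_const_zero] at h1
  rw [Pi.zero_apply, ← h1]
  simp [Matrix.vecMul, dotProduct, A', hDα, mul_comm]

/-- For generic linear forms `ℓ i` vanishing on the linear subspace `A x = 0`, the affine variety
given by the equations `F i + ε i * ℓ i = 0` has no singular point with a relation between the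
gradients involving an index `i₀` with `ε i₀ = 1`. -/
theorem generic_perturbation_not_singular {F : Fin r → MvPolynomial (Fin s) ℂ} {ε : Fin r → ℂ}
    {A : Matrix (Fin m) (Fin s) ℂ} {B : Matrix (Fin s) (Fin m) ℂ} (hAB : A * B = 1)
    (hdim : s + r ≤ 2 * m)
    (D : Fin r × Fin m → Derivation ℂ E E) (ℓ : Fin r × Fin m → E)
    (hD : ∀ i j, D i (ℓ j) = if i = j then 1 else 0)
    (x : Fin s → E) (l : Fin r → E) (i₀ : Fin r) (hε : ε i₀ = 1) (hl : l i₀ = 1)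
    (hF : ∀ i, aeval x (F i) + algebraMap ℂ E (ε i) *
      ∑ j, ℓ (i, j) * (A.map (algebraMap ℂ E) *ᵥ x) j = 0)
    (hsing : ∀ t, ∑ i, l i * (aeval x (pderiv t (F i)) +
      algebraMap ℂ E (ε i) * ∑ j, ℓ (i, j) * algebraMap ℂ E (A j t)) = 0) :
    False := by
  set A' := A.map (algebraMap ℂ E) with hA'
  -- Differentiate equation `i` by `D (i₀, j₀)`, weight by `l i` and sum. The gradient terms cancel
  -- by `hsing`, leaving `l i₀ * ε i₀ * (A' *ᵥ x) j₀`.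
  have hker : A' *ᵥ x = 0 := by
    ext j₀
    let D' := D (i₀, j₀)
    have h1 : ∀ i, ∑ t, (aeval x (pderiv t (F i)) + algebraMap ℂ E (ε i) *
        ∑ j, ℓ (i, j) * algebraMap ℂ E (A j t)) * D' (x t) +
        algebraMap ℂ E (ε i) * (if i₀ = i then (A' *ᵥ x) j₀ else 0) = 0 := fun i => by
      have h2 := congrArg D' (hF i)
      simp only [map_add, map_zero, Derivation.leibniz, Derivation.map_algebraMap,
        map_sum, D'.apply_aeval_mvPolynomial, smul_eq_mul,
        Finset.sum_add_distrib] at h2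
      have h3 : ∑ j, (A' *ᵥ x) j * D' (ℓ (i, j)) = if i₀ = i then (A' *ᵥ x) j₀ else 0 := by
        by_cases hi : i₀ = i <;> simp [D', hD, hi]
      have h4 : ∑ t, (algebraMap ℂ E (ε i) * ∑ j, ℓ (i, j) * algebraMap ℂ E (A j t)) * D' (x t) =
          algebraMap ℂ E (ε i) * ∑ j, ℓ (i, j) * D' ((A' *ᵥ x) j) := by
        simp only [hA', Derivation.mulVec_map_algebraMap]
        simp only [Matrix.mulVec, dotProduct, Finset.mul_sum, Finset.sum_mul]
        rw [Finset.sum_comm]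
        exact Finset.sum_congr rfl fun _ _ => Finset.sum_congr rfl fun _ _ => by
          simp only [Matrix.map_apply]; ring
      rw [h3] at h2
      simp only [add_mul, Finset.sum_add_distrib]
      linear_combination h2 + h4
    have h2 : ∑ i, l i * (∑ t, (aeval x (pderiv t (F i)) + algebraMap ℂ E (ε i) *
        ∑ j, ℓ (i, j) * algebraMap ℂ E (A j t)) * D' (x t)) = 0 := by
      simp only [Finset.mul_sum (Finset.univ : Finset (Fin s))]
      rw [Finset.sum_comm]
      simp only [← mul_assoc, ← Finset.sum_mul, hsing, zero_mul, Finset.sum_const_zero]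
    have h3 : ∑ i, l i * (algebraMap ℂ E (ε i) * (if i₀ = i then (A' *ᵥ x) j₀ else 0)) = 0 := by
      have h4 := Finset.sum_congr (rfl : (Finset.univ : Finset (Fin r)) = _)
        fun i _ => congrArg (l i * ·) (h1 i)
      simpa only [mul_add, Finset.sum_add_distrib, h2, zero_add, mul_zero,
        Finset.sum_const_zero] using h4
    rw [Finset.sum_eq_single i₀ (fun i _ hi => by simp [hi.symm]) (by simp)] at h3
    simpa [hl, hε] using h3
  -- Since `l i₀ = 1` is constant, only `r - 1` multipliers need killing; here this saves the one
  -- dimension.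
  have hK : Module.finrank E (LinearMap.ker A'.mulVecLin) + Fintype.card {i // i ≠ i₀} < m := by
    have h3 := Matrix.finrank_ker_mulVecLin_of_mul_eq_one
      (Matrix.map_algebraMap_mul_eq_one (E := E) hAB)
    rw [← hA'] at h3
    have h4 : Fintype.card {i // i ≠ i₀} = r - 1 := by
      simp [Fintype.card_subtype_compl]
    have := i₀.pos
    omega
  obtain ⟨c, hc, hcx, hcl'⟩ := Derivation.exists_combination_eq_zero (fun j => D (i₀, j)) x
    (fun i : {i // i ≠ i₀} => l i) (LinearMap.ker A'.mulVecLin) (fun D' => by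
    rw [LinearMap.mem_ker, Matrix.mulVecLin_apply]
    ext j
    rw [hA', ← Derivation.mulVec_map_algebraMap, ← hA', hker]
    simp) hK
  refine hc (Matrix.eq_zero_of_vecMul_map_eq_zero (E := E) hAB ?_)
  set D' := ∑ j, c j • D (i₀, j) with hD'
  have hcl : ∀ i, D' (l i) = 0 := fun i => by
    by_cases hi : i = i₀
    · rw [hi, hl, Derivation.map_one_eq_zero]
    · exact hcl' ⟨i, hi⟩
  have hDℓ : ∀ i j, D' (ℓ (i, j)) = if i₀ = i then c j else 0 := fun i j => by
    rw [hD', Derivation.sum_smul_apply]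
    by_cases hi : i₀ = i <;> simp [hD, hi]
  ext t
  have h1 := congrArg D' (hsing t)
  have h2 : ∀ f : MvPolynomial (Fin s) ℂ, D' (aeval x f) = 0 := fun f => by
    rw [Derivation.apply_aeval_mvPolynomial]
    simp [hcx]
  simp only [map_sum, Derivation.leibniz, h2, hcl, smul_zero, add_zero, map_add, map_zero,
    Derivation.map_algebraMap, hDℓ, zero_add] at h1
  rw [Finset.sum_eq_single i₀ (fun i _ hi => by simp [hi.symm]) (by simp)] at h1
  simpa [hl, hε, Matrix.vecMul, dotProduct, A', mul_comm] using h1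

end GenericSolutions

/-! ### Homogeneous equations for conic sets -/

section Homogeneous

theorem MvPolynomial.IsHomogeneous.eval_smul_eq {σ : Type*} {f : MvPolynomial σ ℂ} {d : ℕ}
    (hf : f.IsHomogeneous d) (c : ℂ) (x : σ → ℂ) : eval (c • x) f = c ^ d * eval x f := by
  simp only [eval_eq, Finset.mul_sum]
  refine Finset.sum_congr rfl fun e he => ?_
  have h : ∑ i ∈ e.support, e i = d := by
    rw [← hf (mem_support_iff.1 he), Finsupp.weight_apply]
    simp [Finsupp.sum]
  simp only [Pi.smul_apply, smul_eq_mul, mul_pow, Finset.prod_mul_distrib,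
    Finset.prod_pow_eq_pow_sum, h]
  ring

/-- A conic set contained in a hypersurface is contained in a hypersurface with a homogeneous
equation. -/
theorem MvPolynomial.exists_isHomogeneous_of_conic {σ : Type*} {Φ : MvPolynomial σ ℂ} (hΦ : Φ ≠ 0)
    (Z : Set (σ → ℂ)) (hZ : ∀ a ∈ Z, ∀ c : ℂ, c ≠ 0 → c • a ∈ Z) (hΦZ : ∀ a ∈ Z, eval a Φ = 0) :
    ∃ (e : ℕ) (Ψ : MvPolynomial σ ℂ), Ψ.IsHomogeneous e ∧ Ψ ≠ 0 ∧ ∀ a ∈ Z, eval a Ψ = 0 := by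
  obtain ⟨e, he⟩ : ∃ e, homogeneousComponent e Φ ≠ 0 := by
    by_contra! h
    exact hΦ (by rw [← sum_homogeneousComponent Φ, Finset.sum_eq_zero fun i _ => h i])
  refine ⟨e, _, homogeneousComponent_isHomogeneous e Φ, he, fun a ha => ?_⟩
  -- `p` is `c ↦ Φ (c • a)`, which vanishes for all `c ≠ 0`.
  let p : Polynomial ℂ := ∑ i ∈ Finset.range (Φ.totalDegree + 1),
    Polynomial.monomial i (eval a (homogeneousComponent i Φ))
  have hp : p = 0 := by
    refine Polynomial.eq_zero_of_infinite_isRoot p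
      (((Set.finite_singleton (0 : ℂ)).infinite_compl).mono fun c hc => ?_)
    have h1 := hΦZ _ (hZ a ha c hc)
    rw [← sum_homogeneousComponent Φ, map_sum] at h1
    simp only [(homogeneousComponent_isHomogeneous _ Φ).eval_smul_eq] at h1
    simp only [Set.mem_ofPred_eq, Polynomial.IsRoot, p, Polynomial.eval_finsetSum,
      Polynomial.eval_monomial]
    rw [← h1]
    exact Finset.sum_congr rfl fun _ _ => mul_comm _ _
  by_cases hle : e ≤ Φ.totalDegree
  · have h1 := congrArg (Polynomial.coeff · e) hp
    simpa [p, Polynomial.finsetSum_coeff, Polynomial.coeff_monomial, Nat.lt_succ_iff, hle] using h1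
  · rw [homogeneousComponent_eq_zero _ _ (not_le.1 hle), map_zero]

end Homogeneous

/-! ### Gradients and the Jacobian criterion -/

section Jacobian

variable {N : ℕ}

theorem grad_add (f g : CoordRing N) (x : Fin (N + 1) → ℂ) :
    grad (f + g) x = grad f x + grad g x := by
  ext j; simp [grad]

theorem grad_mul (f g : CoordRing N) (x : Fin (N + 1) → ℂ) :
    grad (f * g) x = eval x f • grad g x + eval x g • grad f x := by
  ext j; simp [grad]

theorem onCone_span_iff {ι : Type*} {F : ι → CoordRing N} {x : Fin (N + 1) → ℂ} :
    OnCone (Ideal.span (Set.range F)) x ↔ ∀ i, eval x (F i) = 0 := by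
  refine ⟨fun h i => h _ (Ideal.subset_span ⟨i, rfl⟩), fun h => ?_⟩
  have : Ideal.span (Set.range F) ≤ RingHom.ker (eval x) :=
    Ideal.span_le.2 (by rintro _ ⟨i, rfl⟩; exact h i)
  exact fun f hf => this hf

/-- By Leibniz, the terms containing a derivative of a coefficient carry a factor that vanishes at
`x`. -/
theorem grad_mem_span {ι : Type*} {F : ι → CoordRing N} {x : Fin (N + 1) → ℂ}
    (hx : ∀ i, eval x (F i) = 0) {f : CoordRing N} (hf : f ∈ Ideal.span (Set.range F)) :
    grad f x ∈ Submodule.span ℂ (Set.range fun i => grad (F i) x) := by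
  induction hf using Submodule.span_induction with
  | mem f hf =>
    obtain ⟨i, rfl⟩ := hf
    exact Submodule.subset_span ⟨i, rfl⟩
  | zero =>
    have : grad (0 : CoordRing N) x = 0 := by ext j; simp [grad]
    rw [this]; exact Submodule.zero_mem _
  | add f g _ _ hf hg => rw [grad_add]; exact Submodule.add_mem _ hf hg
  | smul a f hf' hf =>
    rw [smul_eq_mul, grad_mul, onCone_span_iff.2 hx f hf', zero_smul, add_zero]
    exact Submodule.smul_mem _ _ hf

/-- The Jacobian criterion for an ideal generated by as many elements as its codimension. -/
theorem isSmoothOfCodim_span_iff {c : ℕ} {F : Fin c → CoordRing N} :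
    IsSmoothOfCodim (Ideal.span (Set.range F)) c ↔
      ∀ x, x ≠ 0 → (∀ i, eval x (F i) = 0) → LinearIndependent ℂ fun i => grad (F i) x := by
  constructor
  · intro h x hx0 hx
    obtain ⟨G, g, hG, hind, -, -⟩ := h x hx0 (onCone_span_iff.2 hx)
    rw [linearIndependent_iff_card_le_finrank_span]
    rw [← finrank_span_eq_card hind]
    apply Submodule.finrank_mono
    rw [Submodule.span_le]
    rintro _ ⟨i, rfl⟩
    exact grad_mem_span hx (hG i)
  · intro h x hx0 hx
    exact ⟨F, 1, fun i => Ideal.subset_span ⟨i, rfl⟩, h x hx0 (onCone_span_iff.1 hx), by simp,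
      fun f hf => by simpa using hf⟩

theorem eval_linForm (a x : Fin (N + 1) → ℂ) : eval x (linForm a) = a ⬝ᵥ x := by
  simp [linForm, dotProduct]

theorem grad_linForm (a x : Fin (N + 1) → ℂ) : grad (linForm a) x = a := by
  ext j
  simp [grad, linForm, pderiv_X, Pi.single_apply]

theorem isHomogeneous_linForm (a : Fin (N + 1) → ℂ) : (linForm a).IsHomogeneous 1 :=
  IsHomogeneous.sum _ _ _ fun _ _ => isHomogeneous_C_mul_X _ _

end Jacobian

/-! ### The general hyperplane section -/

section GeneralHyperplane

open Matrix

/-- Hyperplanes through the linear subspace `A x = 0` which are tangent to a complete intersection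
at a point in the chart `x t₀ = 1` lie on a hypersurface. -/
theorem exists_hypersurface_of_tangent_chart {r m s : ℕ} {d : Fin r → ℕ}
    {G : Fin r → MvPolynomial (Fin s) ℂ} (hG : ∀ i, (G i).IsHomogeneous (d i))
    {A : Matrix (Fin m) (Fin s) ℂ} {B : Matrix (Fin s) (Fin m) ℂ} (hAB : A * B = 1)
    (hdim : s + r ≤ 2 * m) (t₀ : Fin s) :
    ∃ Φ : MvPolynomial (Fin m) ℂ, Φ ≠ 0 ∧ ∀ (α : Fin m → ℂ) (x : Fin s → ℂ) (l : Fin r → ℂ),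
      x t₀ = 1 → (∀ i, eval x (G i) = 0) →
      (∀ t, (α ᵥ* A) t = ∑ i, l i * eval x (pderiv t (G i))) → eval α Φ = 0 := by
  let ρ : MvPolynomial (Fin s) ℂ →ₐ[ℂ] MvPolynomial (Fin m ⊕ (Fin s ⊕ Fin r)) ℂ :=
    rename (Sum.inr ∘ Sum.inl)
  let eqn₀ : MvPolynomial (Fin m ⊕ (Fin s ⊕ Fin r)) ℂ := X (Sum.inr (Sum.inl t₀)) - 1
  let eqn₁ : Fin s → MvPolynomial (Fin m ⊕ (Fin s ⊕ Fin r)) ℂ := fun t =>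
    ∑ j, X (Sum.inl j) * C (A j t) - ∑ i, X (Sum.inr (Sum.inr i)) * ρ (pderiv t (G i))
  obtain ⟨Φ, hΦ, h⟩ := exists_hypersurface_of_generic
    ({eqn₀} ∪ Set.range (fun i => ρ (G i)) ∪ Set.range eqn₁)
    (fun E _ _ α y D hD hS => by
      have hρ : ∀ f, aeval (Sum.elim α y) (ρ f) = aeval (y ∘ Sum.inl) f := fun f => by
        simp only [ρ, aeval_rename]
        rfl
      refine generic_hyperplane_not_tangent hG hAB hdim D α hD (y ∘ Sum.inl) (y ∘ Sum.inr) t₀ ?_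
        (fun i => ?_) (fun t => ?_)
      · have := hS eqn₀ (by simp)
        simpa [eqn₀, sub_eq_zero] using this
      · rw [← hρ]
        exact hS _ (by simp)
      · have := hS (eqn₁ t) (by simp)
        simpa [eqn₁, sub_eq_zero, hρ, Matrix.vecMul, dotProduct] using this)
  refine ⟨Φ, hΦ, fun α x l hx hGx ht => h α (Sum.elim x l) ?_⟩
  have hρ : ∀ f, eval (Sum.elim α (Sum.elim x l)) (ρ f) = eval x f := fun f => by
    simp only [ρ, eval_rename]
    rfl
  rintro f ((rfl | ⟨i, rfl⟩) | ⟨t, rfl⟩)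
  · simp [eqn₀, hx]
  · simp [hρ, hGx]
  · simpa [eqn₁, hρ, sub_eq_zero, Matrix.vecMul, dotProduct] using ht t

/-- Hyperplanes through the linear subspace `A x = 0` which are tangent to a complete intersection
lie on a hypersurface with a homogeneous equation. -/
theorem exists_homogeneous_hypersurface_of_tangent {r m s : ℕ} {d : Fin r → ℕ}
    {G : Fin r → MvPolynomial (Fin s) ℂ} (hG : ∀ i, (G i).IsHomogeneous (d i))
    {A : Matrix (Fin m) (Fin s) ℂ} {B : Matrix (Fin s) (Fin m) ℂ} (hAB : A * B = 1)
    (hdim : s + r ≤ 2 * m) :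
    ∃ (e : ℕ) (Φ : MvPolynomial (Fin m) ℂ), Φ.IsHomogeneous e ∧ Φ ≠ 0 ∧
      ∀ (α : Fin m → ℂ) (x : Fin s → ℂ) (l : Fin r → ℂ),
      x ≠ 0 → (∀ i, eval x (G i) = 0) →
      (∀ t, (α ᵥ* A) t = ∑ i, l i * eval x (pderiv t (G i))) → eval α Φ = 0 := by
  choose Φ hΦ h using fun t₀ => exists_hypersurface_of_tangent_chart hG hAB hdim t₀
  let Z : Set (Fin m → ℂ) := {α | ∃ (x : Fin s → ℂ) (l : Fin r → ℂ),
    x ≠ 0 ∧ (∀ i, eval x (G i) = 0) ∧ ∀ t, (α ᵥ* A) t = ∑ i, l i * eval x (pderiv t (G i))}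
  obtain ⟨e, Ψ, hΨe, hΨ, hΨZ⟩ := exists_isHomogeneous_of_conic
    (Finset.prod_ne_zero_iff.2 fun t₀ (_ : t₀ ∈ Finset.univ) => hΦ t₀) Z
    (by
      rintro α ⟨x, l, hx, hGx, ht⟩ c -
      refine ⟨x, c • l, hx, hGx, fun t => ?_⟩
      rw [Matrix.smul_vecMul, Pi.smul_apply, ht, Finset.smul_sum]
      simp [mul_assoc])
    (by
      rintro α ⟨x, l, hx, hGx, ht⟩
      obtain ⟨t₀, ht₀⟩ := Function.ne_iff.1 hx
      rw [Pi.zero_apply] at ht₀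
      rw [map_prod]
      -- Rescale into the chart `x t₀ = 1`; the powers in the multipliers compensate for the
      -- gradients being homogeneous of degree `d i - 1`.
      refine Finset.prod_eq_zero (Finset.mem_univ t₀)
        (h t₀ α ((x t₀)⁻¹ • x) (fun i => l i * x t₀ ^ (d i - 1)) (by simp [ht₀])
        (fun i => by rw [(hG i).eval_smul_eq, hGx, mul_zero]) fun t => ?_)
      rw [ht]
      refine Finset.sum_congr rfl fun i _ => ?_
      rw [(hG i).pderiv.eval_smul_eq, inv_pow]
      field_simp)
  exact ⟨e, Ψ, hΨe, hΨ, fun α x l hx hGx ht => hΨZ α ⟨x, l, hx, hGx, ht⟩⟩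

/-- The general hyperplane through a linear subspace `L` of small dimension meets a smooth complete
intersection in a smooth scheme of codimension one. -/
theorem forGeneralHyperplane_isSmoothOfCodim {N r : ℕ} {d : Fin r → ℕ}
    {L : Submodule ℂ (Fin (N + 1) → ℂ)} {I : Ideal (CoordRing N)}
    (hI : IsSmoothCompleteIntersection d I)
    (hdim : N + 1 + r + 2 * Module.finrank ℂ L ≤ 2 * (N + 1)) (hlt : Module.finrank ℂ L < N + 1) :
    ForGeneralHyperplaneThrough L
      (fun a => IsSmoothOfCodim (I ⊔ Ideal.span {linForm a}) (r + 1)) := by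
  obtain ⟨G, hG, rfl⟩ := hI.exists_equations
  have hsm := isSmoothOfCodim_span_iff.1 hI.smooth
  obtain ⟨m, hm⟩ := Nat.exists_eq_add_of_lt hlt
  obtain ⟨A, B, hAB, hA⟩ := L.exists_matrix_equations (m := m + 1) (by omega)
  obtain ⟨e, Φ, hΦe, hΦ, hbad⟩ := exists_homogeneous_hypersurface_of_tangent hG hAB (by omega)
  -- Hyperplanes through `L` are `α ᵥ* A`, with `α` recovered as `a ᵥ* B`; `Ψ` is `Φ` in the
  -- coordinates `a`.
  let Ψ : MvPolynomial (Fin (N + 1)) ℂ := aeval (fun j => linForm fun t => B t j) Φ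
  have hΨ : ∀ a, eval a Ψ = eval (a ᵥ* B) Φ := fun a => by
    have h1 : (eval a).comp (aeval fun j => linForm fun t => B t j :
        MvPolynomial (Fin (m + 1)) ℂ →ₐ[ℂ] CoordRing N).toRingHom = eval (a ᵥ* B) := by
      ext i
      · simp
      · simp [eval_linForm, Matrix.vecMul, dotProduct_comm]
    exact RingHom.congr_fun h1 Φ
  refine ⟨e, Ψ, ?_, ?_, fun a ha haL hae => ?_⟩
  · have := hΦe.aeval _ fun j => isHomogeneous_linForm fun t => B t j
    rwa [one_mul] at this
  -- The factor `X 0` forces `α ≠ 0`, which `Φ` alone would not do if it were constant.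
  · obtain ⟨α, hα⟩ : ∃ α, eval α (X 0 * Φ) ≠ 0 := by
      by_contra! h
      exact mul_ne_zero (X_ne_zero 0) hΦ (MvPolynomial.funext fun α => by simpa using h α)
    rw [map_mul, eval_X] at hα
    have hαB : (α ᵥ* A) ᵥ* B = α := by rw [Matrix.vecMul_vecMul, hAB, Matrix.vecMul_one]
    refine ⟨α ᵥ* A, fun h => ?_, fun x hx => ?_, ?_⟩
    · rw [h, Matrix.zero_vecMul] at hαB
      simp [← hαB] at hα
    · rw [eval_linForm, ← Matrix.dotProduct_mulVec, (hA x).1 hx, dotProduct_zero]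
    · rw [hΨ, hαB]
      exact right_ne_zero_of_mul hα
  · have haA : (a ᵥ* B) ᵥ* A = a := by
      refine dotProduct_eq _ _ fun x => ?_
      have h1 : x - B *ᵥ (A *ᵥ x) ∈ L := by
        rw [hA, Matrix.mulVec_sub, Matrix.mulVec_mulVec, hAB, Matrix.one_mulVec, sub_self]
      have h2 := haL _ h1
      rw [eval_linForm, dotProduct_sub, sub_eq_zero] at h2
      rw [h2, ← Matrix.dotProduct_mulVec, ← Matrix.dotProduct_mulVec]
    have hspan : Ideal.span (Set.range G) ⊔ Ideal.span {linForm a} =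
        Ideal.span (Set.range (Fin.cons (linForm a) G : Fin (r + 1) → CoordRing N)) := by
      rw [Fin.range_cons, Set.insert_eq, Ideal.span_union, sup_comm]
    change IsSmoothOfCodim _ _
    rw [hspan, isSmoothOfCodim_span_iff]
    intro x hx0 hx
    have hGx : ∀ i, eval x (G i) = 0 := fun i => by simpa using hx i.succ
    have hcons : (fun i => grad ((Fin.cons (linForm a) G : Fin (r + 1) → CoordRing N) i) x) =
        Fin.cons a fun i => grad (G i) x := by
      ext i : 1
      refine Fin.cases ?_ (fun i => ?_) i
      · simp [grad_linForm]
      · simp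
    rw [hcons, linearIndependent_finCons]
    refine ⟨hsm x hx0 hGx, fun hmem => ?_⟩
    obtain ⟨l, hl⟩ := (Submodule.mem_span_range_iff_exists_fun ℂ).1 hmem
    rw [hΨ] at hae
    refine hae (hbad _ x l hx0 hGx fun t => ?_)
    rw [haA, ← hl]
    simp [grad]

end GeneralHyperplane

/-! ### Perturbed cones and the smooth extension -/

section Extension

open Matrix

/-- The coefficients of the linear forms for which the perturbed equations have a singular point with
a relation between the gradients involving the index `i₀` lie on a hypersurface. -/
theorem exists_hypersurface_of_singular {r m s : ℕ} {F : Fin r → MvPolynomial (Fin s) ℂ}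
    {ε : Fin r → ℂ} {A : Matrix (Fin m) (Fin s) ℂ} {B : Matrix (Fin s) (Fin m) ℂ}
    (hAB : A * B = 1) (hdim : s + r ≤ 2 * m) (i₀ : Fin r) (hε : ε i₀ = 1) :
    ∃ Φ : MvPolynomial (Fin r × Fin m) ℂ, Φ ≠ 0 ∧
      ∀ (ℓ : Fin r × Fin m → ℂ) (x : Fin s → ℂ) (l : Fin r → ℂ), l i₀ = 1 →
      (∀ i, eval x (F i) + ε i * ∑ j, ℓ (i, j) * (A *ᵥ x) j = 0) →
      (∀ t, ∑ i, l i * (eval x (pderiv t (F i)) + ε i * ∑ j, ℓ (i, j) * A j t) = 0) →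
      eval ℓ Φ = 0 := by
  let ρ : MvPolynomial (Fin s) ℂ →ₐ[ℂ] MvPolynomial ((Fin r × Fin m) ⊕ (Fin s ⊕ Fin r)) ℂ :=
    rename (Sum.inr ∘ Sum.inl)
  let eqn₀ : MvPolynomial ((Fin r × Fin m) ⊕ (Fin s ⊕ Fin r)) ℂ := X (Sum.inr (Sum.inr i₀)) - 1
  let eqn₁ : Fin r → MvPolynomial ((Fin r × Fin m) ⊕ (Fin s ⊕ Fin r)) ℂ := fun i =>
    ρ (F i) + C (ε i) * ∑ j, X (Sum.inl (i, j)) * ∑ t, C (A j t) * X (Sum.inr (Sum.inl t))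
  let eqn₂ : Fin s → MvPolynomial ((Fin r × Fin m) ⊕ (Fin s ⊕ Fin r)) ℂ := fun t =>
    ∑ i, X (Sum.inr (Sum.inr i)) *
    (ρ (pderiv t (F i)) + C (ε i) * ∑ j, X (Sum.inl (i, j)) * C (A j t))
  obtain ⟨Φ, hΦ, h⟩ := exists_hypersurface_of_generic
    ({eqn₀} ∪ Set.range eqn₁ ∪ Set.range eqn₂)
    (fun E _ _ ℓ y D hD hS => by
      have hρ : ∀ f, aeval (Sum.elim ℓ y) (ρ f) = aeval (y ∘ Sum.inl) f := fun f => by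
        simp only [ρ, aeval_rename]
        rfl
      refine generic_perturbation_not_singular (F := F) hAB hdim D ℓ hD (y ∘ Sum.inl)
        (y ∘ Sum.inr) i₀ hε ?_
        (fun i => ?_) (fun t => ?_)
      · have := hS eqn₀ (by simp)
        simpa [eqn₀, sub_eq_zero] using this
      · have := hS (eqn₁ i) (by simp)
        simpa [eqn₁, hρ, Matrix.mulVec, dotProduct] using this
      · have := hS (eqn₂ t) (by simp)
        simpa [eqn₂, hρ] using this)
  refine ⟨Φ, hΦ, fun ℓ x l hl hF ht => h ℓ (Sum.elim x l) ?_⟩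
  have hρ : ∀ f, eval (Sum.elim ℓ (Sum.elim x l)) (ρ f) = eval x f := fun f => by
    simp only [ρ, eval_rename]
    rfl
  rintro f ((rfl | ⟨i, rfl⟩) | ⟨t, rfl⟩)
  · simp [eqn₀, hl]
  · simpa [eqn₁, hρ, Matrix.mulVec, dotProduct] using hF i
  · simpa [eqn₂, hρ] using ht t

/-- Bertini-type statement: linear forms vanishing on a small linear subspace `M` may be added to
some of the equations so that no relation between the gradients involves these equations. -/
theorem exists_perturbation {r s : ℕ} (F : Fin r → MvPolynomial (Fin s) ℂ) (ε : Fin r → ℂ)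
    (M : Submodule ℂ (Fin s → ℂ)) (hdim : s + r + 2 * Module.finrank ℂ M ≤ 2 * s) :
    ∃ a : Fin r → Fin s → ℂ, (∀ i, ∀ x ∈ M, a i ⬝ᵥ x = 0) ∧
      ∀ (x : Fin s → ℂ) (l : Fin r → ℂ) (i₀ : Fin r), ε i₀ = 1 → l i₀ ≠ 0 →
      (∀ i, eval x (F i) + ε i * (a i ⬝ᵥ x) = 0) →
      ¬ ∀ t, ∑ i, l i * (eval x (pderiv t (F i)) + ε i * a i t) = 0 := by
  obtain ⟨m, hm⟩ := Nat.exists_eq_add_of_le (show Module.finrank ℂ M ≤ s by omega)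
  obtain ⟨A, B, hAB, hA⟩ := M.exists_matrix_equations hm.symm
  have key : ∀ i₀, ∃ Φ : MvPolynomial (Fin r × Fin m) ℂ, Φ ≠ 0 ∧ (ε i₀ = 1 →
      ∀ (ℓ : Fin r × Fin m → ℂ) (x : Fin s → ℂ) (l : Fin r → ℂ), l i₀ = 1 →
      (∀ i, eval x (F i) + ε i * ∑ j, ℓ (i, j) * (A *ᵥ x) j = 0) →
      (∀ t, ∑ i, l i * (eval x (pderiv t (F i)) + ε i * ∑ j, ℓ (i, j) * A j t) = 0) →
      eval ℓ Φ = 0) := fun i₀ => by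
    by_cases hε : ε i₀ = 1
    · obtain ⟨Φ, hΦ, h⟩ := exists_hypersurface_of_singular (F := F) hAB (by omega) i₀ hε
      exact ⟨Φ, hΦ, fun _ => h⟩
    · exact ⟨1, one_ne_zero, fun h => absurd h hε⟩
  choose Φ hΦ hbad using key
  obtain ⟨ℓ, hℓ⟩ : ∃ ℓ, eval ℓ (∏ i, Φ i) ≠ 0 := by
    by_contra! h
    exact Finset.prod_ne_zero_iff.2 (fun i _ => hΦ i)
      (MvPolynomial.funext fun ℓ => by simpa using h ℓ)
  rw [map_prod] at hℓ
  refine ⟨fun i => (fun j => ℓ (i, j)) ᵥ* A, fun i x hx => ?_, fun x l i₀ hε hl hF hsing => ?_⟩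
  · rw [← Matrix.dotProduct_mulVec, (hA x).1 hx, dotProduct_zero]
  · refine Finset.prod_ne_zero_iff.1 hℓ i₀ (Finset.mem_univ _)
      (hbad i₀ hε ℓ x (fun i => (l i₀)⁻¹ * l i) (inv_mul_cancel₀ hl) (fun i => ?_) fun t => ?_)
    · rw [← hF i, ← Matrix.dotProduct_mulVec]
      rfl
    · simp only [mul_assoc, ← Finset.mul_sum]
      exact mul_eq_zero_of_right _ (hsing t)

/-- The substitution `X_s ↦ X_s - v_s X_{N+1}`, dual to the projection of `ℙ^(N+1)` to the
hyperplane `X_{N+1} = 0` from the point `(v, 1)`. -/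
noncomputable def coneHom {N : ℕ} (v : Fin (N + 1) → ℂ) : CoordRing N →ₐ[ℂ] CoordRing (N + 1) :=
  aeval fun s => X s.castSucc - C (v s) * X (Fin.last (N + 1))

section ConeHom

variable {N : ℕ} (v : Fin (N + 1) → ℂ)

theorem eval_coneHom (z : Fin (N + 1 + 1) → ℂ) (f : CoordRing N) :
    eval z (coneHom v f) = eval (fun s => z s.castSucc - z (Fin.last _) * v s) f := by
  have h : (eval z).comp (coneHom v).toRingHom =
      eval (fun s => z s.castSucc - z (Fin.last _) * v s) := by
    ext s <;> simp [coneHom, mul_comm]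
  exact RingHom.congr_fun h f

theorem pderiv_castSucc_coneHom (s : Fin (N + 1)) (f : CoordRing N) :
    pderiv s.castSucc (coneHom v f) = coneHom v (pderiv s f) := by
  induction f using MvPolynomial.induction_on with
  | C a => simp [coneHom]
  | add p q hp hq => simp [hp, hq]
  | mul_X p i hp =>
    have h : pderiv s.castSucc (coneHom v (X i)) = coneHom v (pderiv s (X i)) := by
      by_cases his : i = s
      · subst his
        simp [coneHom, pderiv_X_of_ne (Fin.castSucc_lt_last i).ne']
      · simp [coneHom, pderiv_X_of_ne (Fin.castSucc_lt_last s).ne', pderiv_X_of_ne his,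
          pderiv_X_of_ne (fun h => his (Fin.castSucc_injective _ h))]
    simp only [map_mul, Derivation.leibniz, map_add, hp, h, smul_eq_mul]

theorem isHomogeneous_coneHom {f : CoordRing N} {d : ℕ} (hf : f.IsHomogeneous d) :
    (coneHom v f).IsHomogeneous d := by
  have := hf.aeval (fun s => X s.castSucc - C (v s) * X (Fin.last (N + 1)) :
    Fin (N + 1) → CoordRing (N + 1)) (n := 1) fun s =>
      (isHomogeneous_X _ _).sub (isHomogeneous_C_mul_X _ _)
  rwa [one_mul] at this

theorem restrictToHyperplane_coneHom (f : CoordRing N) :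
    restrictToHyperplane N (coneHom v f) = f := by
  have h : (restrictToHyperplane N).comp (coneHom v).toRingHom = RingHom.id _ := by
    ext s <;> simp [coneHom, restrictToHyperplane]
  exact RingHom.congr_fun h f

end ConeHom

/-- A smooth complete intersection in a hyperplane extends to a smooth complete intersection of the
same multidegree which contains a given linear subspace `L` of small dimension. -/
theorem exists_smooth_extension {N r : ℕ} {d : Fin r → ℕ}
    {L : Submodule ℂ (Fin (N + 1 + 1) → ℂ)} {M : Submodule ℂ (Fin (N + 1) → ℂ)}
    (hM : M = L.comap (hyperplaneIncl N)) (hML : Module.finrank ℂ M < Module.finrank ℂ L)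
    (hM0 : 0 < Module.finrank ℂ M) (hdim : N + 1 + r + 2 * Module.finrank ℂ M ≤ 2 * (N + 1))
    {I : Ideal (CoordRing N)} (hI : IsSmoothCompleteIntersection d I) (hMI : ContainsLinear I M) :
    ∃ J : Ideal (CoordRing (N + 1)), IsSmoothCompleteIntersection d J ∧
      ContainsLinear J L ∧ interHyperplane J = I := by
  obtain ⟨F, hF, rfl⟩ := hI.exists_equations
  have hsm := isSmoothOfCodim_span_iff.1 hI.smooth
  have hMF : ∀ x ∈ M, ∀ i, eval x (F i) = 0 := fun x hx => onCone_span_iff.1 (hMI x hx)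
  have hpos := hI.deg_pos
  obtain ⟨w, hwL, hw⟩ : ∃ w ∈ L, w (Fin.last _) = 1 := by
    -- Otherwise `L` would lie in the hyperplane, and its dimension could not exceed that of `M`.
    obtain ⟨w, hwL, hw⟩ : ∃ w ∈ L, w (Fin.last _) ≠ 0 := by
      by_contra! h
      have h1 : L ≤ M.map (hyperplaneIncl N) := fun z hz => by
        have h2 : hyperplaneIncl N (fun s => z s.castSucc) = z := by
          ext j
          refine Fin.lastCases ?_ (fun i => ?_) j
          · simp [hyperplaneIncl, h z hz]
          · simp [hyperplaneIncl]
        exact ⟨_, by rw [hM, SetLike.mem_coe, Submodule.mem_comap, h2]; exact hz, h2⟩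
      exact absurd ((Submodule.finrank_mono h1).trans (Submodule.finrank_map_le _ _))
        (not_le.2 hML)
    exact ⟨(w (Fin.last _))⁻¹ • w, L.smul_mem _ hwL, by simp [hw]⟩
  let v : Fin (N + 1) → ℂ := fun s => w s.castSucc
  have hproj : ∀ z ∈ L, (fun s => z s.castSucc - z (Fin.last _) * v s) ∈ M := fun z hz => by
    have h2 : hyperplaneIncl N (fun s => z s.castSucc - z (Fin.last _) * v s) =
        z - z (Fin.last _) • w := by
      ext j
      refine Fin.lastCases ?_ (fun i => ?_) j
      · simp [hyperplaneIncl, hw]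
      · simp [hyperplaneIncl, v]
    rw [hM, Submodule.mem_comap, h2]
    exact L.sub_mem hz (L.smul_mem _ hwL)
  -- Linear equations stay unperturbed: for `d i = 1` the factor `t ^ (d i - 1)` is 1 and would not
  -- vanish on the hyperplane.
  let ε : Fin r → ℂ := fun i => if d i = 1 then 0 else 1
  obtain ⟨a, haM, ha⟩ := exists_perturbation F ε M hdim
  have hε : ∀ i, ε i * 0 ^ (d i - 1) = 0 := fun i => by
    by_cases hi : d i = 1
    · simp [ε, hi]
    · have := hpos i
      rw [zero_pow (by omega), mul_zero]
  obtain ⟨x₀, hx₀M, hx₀⟩ := (Submodule.ne_bot_iff _).1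
    (show M ≠ ⊥ by rintro rfl; simp at hM0)
  have hind : ∀ x, (∀ i, eval x (F i) + ε i * (a i ⬝ᵥ x) = 0) →
      LinearIndependent ℂ fun i => grad (F i) x + ε i • a i := fun x hx => by
    rw [Fintype.linearIndependent_iff]
    intro l hl
    have hl0 : ∀ i, d i ≠ 1 → l i = 0 := fun i hi => by
      by_contra hne
      refine ha x l i (by simp [ε, hi]) hne hx fun t => ?_
      simpa [grad, mul_add] using congrFun hl t
    -- By `hl0` only linear equations enter the relation. Their gradients are constant, so it can be
    -- read at `x₀ ∈ M`, where `X` is smooth.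
    refine Fintype.linearIndependent_iff.1 (hsm x₀ hx₀ (hMF x₀ hx₀M)) l ?_
    rw [← hl]
    refine Finset.sum_congr rfl fun i _ => ?_
    by_cases hi : d i = 1
    · have h0 : grad (F i) x₀ = grad (F i) x := by
        ext t
        have hc : ∀ y, eval y (pderiv t (F i)) = eval 0 (pderiv t (F i)) := fun y => by
          have := (hF i).pderiv (i := t) |>.eval_smul_eq 0 y
          rw [hi] at this
          simpa using this.symm
        rw [grad, grad, hc, hc x]
      simp [h0, ε, hi]
    · simp [hl0 i hi]
  let G : Fin r → CoordRing (N + 1) := fun i =>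
    coneHom v (F i) + C (ε i) * X (Fin.last _) ^ (d i - 1) * coneHom v (linForm (a i))
  have hG : ∀ z i, eval z (G i) = eval (fun s => z s.castSucc - z (Fin.last _) * v s) (F i) +
      ε i * z (Fin.last _) ^ (d i - 1) * (a i ⬝ᵥ fun s => z s.castSucc - z (Fin.last _) * v s) :=
    fun z i => by simp [G, eval_coneHom, eval_linForm]
  have hgrad : ∀ z i, (fun s : Fin (N + 1) => grad (G i) z s.castSucc) =
      grad (F i) (fun s => z s.castSucc - z (Fin.last _) * v s) +
        (ε i * z (Fin.last _) ^ (d i - 1)) • a i := fun z i => by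
    ext s
    have h1 := congrFun (grad_linForm (a i) (fun s => z s.castSucc - z (Fin.last _) * v s)) s
    simp only [grad] at h1
    simp [grad, G, Derivation.leibniz_pow, pderiv_castSucc_coneHom, eval_coneHom, h1,
      pderiv_X_of_ne (Fin.castSucc_lt_last s).ne']
  refine ⟨Ideal.span (Set.range G), ⟨hpos, ⟨G, fun i => ?_, rfl⟩, ?_⟩, fun z hz => ?_, ?_⟩
  · refine (isHomogeneous_coneHom v (hF i)).add ?_
    have := ((isHomogeneous_C_mul_X_pow (ε i) (Fin.last (N + 1)) (d i - 1))).mul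
      (isHomogeneous_coneHom v (isHomogeneous_linForm (a i)))
    rwa [Nat.sub_add_cancel (hpos i)] at this
  · rw [isSmoothOfCodim_span_iff]
    intro z hz0 hz
    -- It suffices that the gradients are independent after dropping the last coordinate.
    apply LinearIndependent.of_comp (LinearMap.funLeft ℂ ℂ (Fin.castSucc : Fin (N + 1) → _))
    have hcomp := funext (hgrad z)
    change LinearIndependent ℂ fun i => (fun s : Fin (N + 1) => grad (G i) z s.castSucc)
    rw [hcomp]
    clear hcomp
    simp only [hG] at hz
    set t := z (Fin.last _) with ht
    set x := fun s : Fin (N + 1) => z s.castSucc - t * v s with hx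
    by_cases ht0 : t = 0
    · simp only [ht0, hε, zero_mul, zero_smul, add_zero] at hz ⊢
      refine hsm x (fun hx0 => hz0 ?_) hz
      ext j
      refine Fin.lastCases ht0 (fun i => ?_) j
      simpa [hx, ht0] using congrFun hx0 i
    -- Off the hyperplane, dividing by `t` moves the point to the affine system of `hind`; each
    -- truncated gradient is scaled by `t ^ (d i - 1)`.
    · have hxu : x = t • (t⁻¹ • x) := by rw [smul_smul, mul_inv_cancel₀ ht0, one_smul]
      set u := t⁻¹ • x
      have hpow : ∀ i, t ^ d i = t ^ (d i - 1) * t := fun i => by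
        rw [← pow_succ, Nat.sub_add_cancel (hpos i)]
      have hu : ∀ i, eval u (F i) + ε i * (a i ⬝ᵥ u) = 0 := fun i => by
        have h1 := hz i
        rw [hxu, (hF i).eval_smul_eq, dotProduct_smul, smul_eq_mul, hpow] at h1
        have h2 : t ^ (d i - 1) * t * (eval u (F i) + ε i * (a i ⬝ᵥ u)) = 0 := by
          linear_combination h1
        exact (mul_eq_zero.1 h2).resolve_left (mul_ne_zero (pow_ne_zero _ ht0) ht0)
      convert (hind u hu).units_smul fun i => Units.mk0 (t ^ (d i - 1)) (pow_ne_zero _ ht0) using 2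
        with i
      rw [hxu]
      ext s
      simp only [grad, Pi.add_apply, Pi.smul_apply, smul_eq_mul, Pi.smul_apply',
        (hF i).pderiv.eval_smul_eq, Units.smul_def, Units.val_mk0]
      ring
  · rw [onCone_span_iff]
    intro i
    rw [hG, hMF _ (hproj z hz), haM _ _ (hproj z hz), mul_zero, add_zero]
  · have hres : ∀ i, restrictToHyperplane N (G i) = F i := fun i => by
      have h1 : restrictToHyperplane N (X (Fin.last _)) = 0 := by simp [restrictToHyperplane]
      have h2 : restrictToHyperplane N (C (ε i)) = C (ε i) := by simp [restrictToHyperplane]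
      have h3 := congrArg (C : ℂ → CoordRing N) (hε i)
      rw [map_mul, map_pow, map_zero] at h3
      simp only [G, map_add, map_mul, map_pow, restrictToHyperplane_coneHom, h1, h2, h3, zero_mul,
        add_zero]
    rw [interHyperplane, Ideal.map_span, ← Set.range_comp]
    congr 2
    exact funext hres

end Extension

theorem lemma3p4 (n r k : ℕ) (d : Fin r → ℕ)
    (L : Submodule ℂ (Fin (n + r + 1 + 1) → ℂ)) (M : Submodule ℂ (Fin (n + r + 1) → ℂ))
    (hL : Module.finrank ℂ L = k + 2)
    (hM : M = L.comap (hyperplaneIncl (n + r))) (hMdim : Module.finrank ℂ M = k + 1)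
    (IX : Ideal (CoordRing (n + r))) (hX : IsSmoothCompleteIntersection d IX)
    (hMX : ContainsLinear IX M) :
    ((k : ℝ) < (n : ℝ) / 2 →
      ∃ IY : Ideal (CoordRing (n + r + 1)), IsSmoothCompleteIntersection d IY ∧
        ContainsLinear IY L ∧ interHyperplane IY = IX) ∧
    ((k : ℝ) < ((n : ℝ) - 1) / 2 →
      ∀ IY : Ideal (CoordRing (n + r + 1)), IsSmoothCompleteIntersection d IY →
        ContainsLinear IY L → interHyperplane IY = IX →
        ForGeneralHyperplaneThrough L
          (fun a => IsSmoothOfCodim (IY ⊔ Ideal.span {linForm a}) (r + 1))) := by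
  -- In both parts the linear space has codimension `n + r - k`. With `s = n + r + 1` in (i) and `s
  -- = n + r + 2` in (ii), the bound `s + r ≤ 2 * m` reads `2 * k + 1 ≤ n` and `2 * k + 2 ≤ n`.
  refine ⟨fun hk => ?_, fun hk IY hY _ _ => ?_⟩
  · have hk' : 2 * k < n := by
      have : ((2 * k : ℕ) : ℝ) < n := by push_cast; linarith
      exact_mod_cast this
    exact exists_smooth_extension hM (by omega) (by omega) (by omega) hX hMX
  · have hk' : 2 * k + 1 < n := by
      have : ((2 * k + 1 : ℕ) : ℝ) < n := by push_cast; linarith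
      exact_mod_cast this
    exact forGeneralHyperplane_isSmoothOfCodim hY (by omega) (by omega)
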